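/- For $z\in\mathbb C$ put $\|z\|=\max\{|\Re z|,|\Im z|\}$ and let $[z]=\lfloor \Re z+\tfrac12\rfloor+i\lfloor \Im z+\tfrac12\rfloor\in\mathbb Z[i]$. Let $\mathfrak F=\{z\in\mathbb C:-\tfrac12\le \Re z,\ \Im z<\tfrac12\}=\{z\in\mathbb C:[z]=0\}$. For $z\in\mathfrak F$ put $z_1=z$ and, as long as $z_n\ne0$, $a_n=[1/z_n]$ and $z_{n+1}=1/z_n-a_n$; the sequence $(a_n)_{n\ge1}$ of Gaussian integers is the Hurwitz continued fraction of $z$, and we write $z=[0;a_1,a_2,\ldots]$ if it is infinite. **Lemma.** Let $f,g:\{1,2,3,\ldots\}\to\mathbb R_{>0}$ be functions such that for some fixed $c'$ with $0<c'<1$ we have $\sqrt8\le f(n)<c'g(n)$ for all $n\ge1$, such that for every $n\ge1$ the interval $[f(n),g(n)]$ contains an integer, such that $f(n)\to\infty$ as $n\to\infty$, and such that $$\limsup_{n\to\infty}\frac{\log\log g(n)}{\log n}<1 .$$ Then the set $$E_{f,g}=\{z=[0;a_1,a_2,a_3,\ldots]\in\mathfrak F:\ f(n)\le\|a_n\|\le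 g(n)\ \text{for all } n\ge1\}$$ has Hausdorff dimension $1$. -/

import Mathlib

open Filter Topology

noncomputable section

/-- The Gaussian integer `[z] = ⌊Re z + 1/2⌋ + i ⌊Im z + 1/2⌋` nearest to `z`. -/
def nearestGaussian (z : ℂ) : GaussianInt :=
  ⟨⌊z.re + 1 / 2⌋, ⌊z.im + 1 / 2⌋⟩

/-- The half-open unit square `𝔉`, that is, the set of `z` with `[z] = 0`. -/
def hurwitzSquare : Set ℂ :=
  {z | (-(1 / 2) ≤ z.re ∧ z.re < 1 / 2) ∧ (-(1 / 2) ≤ z.im ∧ z.im < 1 / 2)}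

/-- The Hurwitz map `T z = 1 / z - [1 / z]`. It is meant for `z ≠ 0`; the value at `0` is
irrelevant, see `HasInfiniteHCF`. -/
def hurwitzMap (z : ℂ) : ℂ :=
  1 / z - (nearestGaussian (1 / z) : ℂ)

/-- `hurwitzRemainder z n` is `T ^ n (z - [z])`. -/
def hurwitzRemainder (z : ℂ) : ℕ → ℂ
  | 0 => z - (nearestGaussian z : ℂ)
  | n + 1 => hurwitzMap (hurwitzRemainder z n)

/-- The elements of the Hurwitz continued fraction `[a₀; a₁, a₂, …]` of `z`: `a₀ = [z]` and
`aₙ₊₁ = [1 / T ^ n (z - [z])]`, as long as `T ^ n (z - [z]) ≠ 0`. -/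
def hurwitzElement (z : ℂ) : ℕ → GaussianInt
  | 0 => nearestGaussian z
  | n + 1 => nearestGaussian (1 / hurwitzRemainder z n)

/-- The Hurwitz algorithm never stops on `z`, so that all elements `aₙ` of `z` are defined. -/
def HasInfiniteHCF (z : ℂ) : Prop :=
  ∀ n, hurwitzRemainder z n ≠ 0

/-- `‖z‖ = max (|Re z|, |Im z|)`. -/
def maxNorm (z : ℂ) : ℝ :=
  max |z.re| |z.im|

/-- The set `E_{f,g}` of all `z = [0; a₁, a₂, …]` in `𝔉` with
`f n ≤ ‖aₙ‖ ≤ g n` for all `n ≥ 1`. -/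
def hurwitzBand (f g : ℕ → ℝ) : Set ℂ :=
  {z | z ∈ hurwitzSquare ∧ HasInfiniteHCF z ∧
    ∀ n : ℕ, 1 ≤ n → f n ≤ maxNorm (hurwitzElement z n) ∧ maxNorm (hurwitzElement z n) ≤ g n}

end

/-! Lower bound. Elements of modulus at least `14 / 5` can be prescribed freely (`exists_isTail`).
The `n`-th band contains at least a constant times `f n ^ 2` Gaussian integers of modulus `O(f n)`
(`exists_bandDigits`), so mixed radix digits of `x ∈ [0, 1)` can be recoded as elements in the
bands. If two points first differ at index `n`, their radix distance is at most about `∏ f⁻²` over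
the earlier indices, while their images are at least about `∏ f⁻²` apart, with index `n` included
(`IsTail.separation`). As `f → ∞`, constants per digit are negligible, and the growth condition
controls the extra factor, so the inverse map is Hölder with every exponent `r < 1`
(`exists_holder_const`). Hence the dimension is at least `r`.

Upper bound. Cylinders have diameter at most `2 * ∏ (9 / 4) / ‖a‖ ^ 2` (`norm_remainder_sub_le`).
For `s > 1` the series `∑ ‖a‖ ^ (-2 * s)` over `ℤ[i]` converges, so `f → ∞` makes its sum over late
bands small, and the `s`-sums over cylinders stay bounded. -/

/-! ### Rounding and remainders. -/

lemma maxNorm_le_norm (z : ℂ) : maxNorm z ≤ ‖z‖ :=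
  max_le (Complex.abs_re_le_norm z) (Complex.abs_im_le_norm z)

lemma norm_le_of_mem_hurwitzSquare {z : ℂ} (hz : z ∈ hurwitzSquare) : ‖z‖ ≤ 3 / 4 := by
  obtain ⟨⟨h1, h2⟩, h3, h4⟩ := hz
  refine abs_le_of_sq_le_sq' ?_ (by norm_num) |>.2
  rw [Complex.sq_norm, Complex.normSq_apply]
  nlinarith

lemma sub_nearestGaussian_mem (z : ℂ) : z - (nearestGaussian z : ℂ) ∈ hurwitzSquare := by
  have h1 := Int.floor_le (z.re + 1 / 2)
  have h2 := Int.lt_floor_add_one (z.re + 1 / 2)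
  have h3 := Int.floor_le (z.im + 1 / 2)
  have h4 := Int.lt_floor_add_one (z.im + 1 / 2)
  simp only [hurwitzSquare, nearestGaussian, Set.mem_ofPred_eq, Complex.sub_re, Complex.sub_im,
    GaussianInt.re_toComplex, GaussianInt.im_toComplex]
  refine ⟨⟨?_, ?_⟩, ?_, ?_⟩ <;> linarith

lemma hurwitzRemainder_mem (z : ℂ) : ∀ n, hurwitzRemainder z n ∈ hurwitzSquare
  | 0 => sub_nearestGaussian_mem z
  | _ + 1 => sub_nearestGaussian_mem _

lemma nearestGaussian_eq_zero {z : ℂ} (hz : z ∈ hurwitzSquare) : nearestGaussian z = 0 := by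
  obtain ⟨⟨h1, h2⟩, h3, h4⟩ := hz
  have e1 : ⌊z.re + 1 / 2⌋ = 0 := Int.floor_eq_zero_iff.2 ⟨by linarith, by linarith⟩
  have e2 : ⌊z.im + 1 / 2⌋ = 0 := Int.floor_eq_zero_iff.2 ⟨by linarith, by linarith⟩
  simp only [nearestGaussian, e1, e2]
  rfl

lemma nearestGaussian_add (a : GaussianInt) {w : ℂ} (hw : w ∈ hurwitzSquare) :
    nearestGaussian (a + w) = a := by
  obtain ⟨⟨h1, h2⟩, h3, h4⟩ := hw
  have e1 : ⌊((a : ℂ) + w).re + 1 / 2⌋ = a.re := by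
    rw [Int.floor_eq_iff, Complex.add_re, ← GaussianInt.intCast_re]
    constructor <;> linarith
  have e2 : ⌊((a : ℂ) + w).im + 1 / 2⌋ = a.im := by
    rw [Int.floor_eq_iff, Complex.add_im, ← GaussianInt.intCast_im]
    constructor <;> linarith
  simp only [nearestGaussian, e1, e2]

lemma mem_hurwitzSquare_of_norm_lt {z : ℂ} (hz : ‖z‖ < 1 / 2) : z ∈ hurwitzSquare := by
  have h1 := abs_lt.1 ((Complex.abs_re_le_norm z).trans_lt hz)
  have h2 := abs_lt.1 ((Complex.abs_im_le_norm z).trans_lt hz)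
  exact ⟨⟨by linarith, h1.2⟩, by linarith, h2.2⟩

lemma hurwitzRemainder_mul {z : ℂ} (hz : HasInfiniteHCF z) (n : ℕ) :
    hurwitzRemainder z n * (hurwitzElement z (n + 1) + hurwitzRemainder z (n + 1)) = 1 := by
  have h := hz n
  simp only [hurwitzElement, hurwitzRemainder, hurwitzMap]
  field_simp
  ring

/-! ### Continued fractions with prescribed large elements. -/

/-- `w` is the sequence of remainders of a continued fraction with elements `a`. -/
structure IsTail (a : ℕ → GaussianInt) (w : ℕ → ℂ) : Prop where
  norm_le : ∀ k, ‖w k‖ ≤ 9 / 20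
  mul_eq : ∀ k, w k * (a k + w (k + 1)) = 1

namespace IsTail

variable {a : ℕ → GaussianInt} {w : ℕ → ℂ}

lemma mem_square (h : IsTail a w) (k : ℕ) : w k ∈ hurwitzSquare :=
  mem_hurwitzSquare_of_norm_lt ((h.norm_le k).trans_lt (by norm_num))

lemma ne_zero (h : IsTail a w) (k : ℕ) : w k ≠ 0 := left_ne_zero_of_mul_eq_one (h.mul_eq k)

lemma one_div_eq (h : IsTail a w) (k : ℕ) : 1 / w k = a k + w (k + 1) := by
  rw [div_eq_iff (h.ne_zero k), mul_comm, h.mul_eq]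

/-- Since `9 / 20 < 1 / 2`, every tail lies inside the square, so rounding `a k + w (k + 1)` returns
exactly `a k`. -/
lemma remainder_eq (h : IsTail a w) (k : ℕ) : hurwitzRemainder (w 0) k = w k := by
  induction k with
  | zero => simp [hurwitzRemainder, nearestGaussian_eq_zero (h.mem_square 0)]
  | succ k ih =>
    simp [hurwitzRemainder, hurwitzMap, ih, -one_div, h.one_div_eq,
      nearestGaussian_add _ (h.mem_square (k + 1))]

lemma hasInfiniteHCF (h : IsTail a w) : HasInfiniteHCF (w 0) := fun k => by
  rw [h.remainder_eq]; exact h.ne_zero k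

lemma element_eq (h : IsTail a w) (k : ℕ) : hurwitzElement (w 0) (k + 1) = a k := by
  rw [hurwitzElement, h.remainder_eq, h.one_div_eq, nearestGaussian_add _ (h.mem_square _)]

end IsTail

/-- The disc of radius `9 / 20` is invariant because `14 / 5 - 9 / 20 = 47 / 20` and `20 / 47 < 9 /
20`; moreover `14 / 5 < √8`. -/
lemma norm_inv_add_le {a w : ℂ} (ha : 14 / 5 ≤ ‖a‖) (hw : ‖w‖ ≤ 9 / 20) :
    ‖(a + w)⁻¹‖ ≤ 9 / 20 := by
  have h : 47 / 20 ≤ ‖a + w‖ := by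
    have := norm_sub_le (a + w) w
    rw [add_sub_cancel_right] at this
    linarith
  rw [norm_inv]
  exact (inv_anti₀ (by norm_num) h).trans (by norm_num)

/-- Finitely many equations are solved backwards from the tail `0`; compactness then gives all of
them at once. -/
lemma exists_finite_tail (n : ℕ) : ∀ a : ℕ → GaussianInt, (∀ k, 14 / 5 ≤ ‖(a k : ℂ)‖) →
    ∃ w : ℕ → ℂ, (∀ k, ‖w k‖ ≤ 9 / 20) ∧ ∀ k < n, w k * (a k + w (k + 1)) = 1 := by
  induction n with
  | zero => exact fun a _ => ⟨0, fun k => by norm_num, fun k hk => by omega⟩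
  | succ n ih =>
    intro a ha
    obtain ⟨w, hw, hm⟩ := ih (fun k => a (k + 1)) (fun k => ha (k + 1))
    have h0 := norm_inv_add_le (ha 0) (hw 0)
    refine ⟨fun k => Nat.casesOn k (a 0 + w 0)⁻¹ w, ?_, ?_⟩
    · rintro (_ | k)
      · exact h0
      · exact hw k
    · rintro (_ | k) hk
      · refine inv_mul_cancel₀ fun h => ?_
        have := norm_sub_le ((a 0 : ℂ) + w 0) (w 0)
        rw [add_sub_cancel_right, h, norm_zero] at this
        linarith [ha 0, hw 0]
      · exact hm k (by omega)

/-- Every sequence of Gaussian integers of modulus at least `14 / 5` occurs as the sequence of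
elements of a Hurwitz continued fraction. -/
lemma exists_isTail (a : ℕ → GaussianInt) (ha : ∀ k, 14 / 5 ≤ ‖(a k : ℂ)‖) :
    ∃ w, IsTail a w := by
  -- Nested nonempty closed subsets of a compact product of discs.
  let S : ℕ → Set (ℕ → ℂ) := fun n =>
    (Set.univ.pi fun _ => Metric.closedBall 0 (9 / 20)) ∩
      ⋂ k, ⋂ (_ : k < n), {w | w k * (a k + w (k + 1)) = 1}
  have hc : IsCompact (Set.univ.pi fun _ : ℕ => Metric.closedBall (0 : ℂ) (9 / 20)) :=
    isCompact_univ_pi fun _ => isCompact_closedBall _ _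
  have hcl (n : ℕ) : IsClosed (S n) := by
    refine hc.isClosed.inter (isClosed_iInter fun k => isClosed_iInter fun _ => ?_)
    exact isClosed_eq (by fun_prop) continuous_const
  obtain ⟨w, hw⟩ := IsCompact.nonempty_iInter_of_sequence_nonempty_isCompact_isClosed S
    (fun n => Set.inter_subset_inter_right _ (Set.iInter_mono fun k =>
      Set.iInter_mono' fun hk => ⟨hk.trans n.lt_succ_self, subset_rfl⟩))
    (fun n => by
      obtain ⟨w, h1, h2⟩ := exists_finite_tail n a ha
      exact ⟨w, fun k _ => by simpa using h1 k, by simpa using h2⟩)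
    (hc.of_isClosed_subset (hcl 0) Set.inter_subset_left) hcl
  rw [Set.mem_iInter] at hw
  refine ⟨w, fun k => ?_, fun k => ?_⟩
  · simpa using (hw 0).1 k (Set.mem_univ k)
  · have := (hw (k + 1)).2
    simp only [Set.mem_iInter, Set.mem_ofPred_eq] at this
    exact this k k.lt_succ_self

/-- Inversion satisfies `u - v = -(x - y) * u * v`, so it expands distances by at most `R ^ 2`. -/
lemma norm_sub_le_of_mul_eq_one {x y u v : ℂ} {R : ℝ} (hx : x * u = 1) (hy : y * v = 1)
    (hu : ‖u‖ ≤ R) (hv : ‖v‖ ≤ R) : ‖u - v‖ ≤ ‖x - y‖ * R ^ 2 := by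
  have e : u - v = -((x - y) * (u * v)) := by linear_combination v * hx - u * hy
  rw [e, norm_neg, norm_mul, norm_mul, sq]
  gcongr
  exact (norm_nonneg u).trans hu

lemma IsTail.norm_sub_le_mul_prod {a b : ℕ → GaussianInt} {w v : ℕ → ℂ} {R : ℕ → ℝ}
    (hw : IsTail a w) (hv : IsTail b v) (ha : ∀ k, ‖(a k : ℂ)‖ + 1 / 2 ≤ R k)
    (hb : ∀ k, ‖(b k : ℂ)‖ + 1 / 2 ≤ R k) (n : ℕ) (hab : ∀ k < n, a k = b k) :
    ‖w n - v n‖ ≤ ‖w 0 - v 0‖ * ∏ k ∈ Finset.range n, R k ^ 2 := by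
  induction n with
  | zero => simp
  | succ n ih =>
    have h := norm_sub_le_of_mul_eq_one (R := R n) (hw.mul_eq n) (hv.mul_eq n)
      ((norm_add_le _ _).trans (by linarith [ha n, hw.norm_le (n + 1)]))
      ((norm_add_le _ _).trans (by linarith [hb n, hv.norm_le (n + 1)]))
    rw [hab n n.lt_succ_self, add_sub_add_left_eq_sub] at h
    rw [Finset.prod_range_succ, ← mul_assoc]
    exact h.trans (by gcongr; exact ih fun k hk => hab k (hk.trans n.lt_succ_self))

lemma one_le_norm_sub {a b : GaussianInt} (hab : a ≠ b) : 1 ≤ ‖(a : ℂ) - b‖ := by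
  have h : 0 < (a - b).norm := GaussianInt.norm_pos.2 (sub_ne_zero.2 hab)
  have h1 : (1 : ℝ) ≤ ((a - b).norm : ℝ) := by exact_mod_cast h
  rw [GaussianInt.intCast_real_norm, Complex.normSq_eq_norm_sq, GaussianInt.toComplex_sub] at h1
  nlinarith [norm_nonneg ((a : ℂ) - b)]

/-- Continued fractions that first differ in their `n`-th element are well separated. -/
lemma IsTail.separation {a b : ℕ → GaussianInt} {w v : ℕ → ℂ} {R : ℕ → ℝ}
    (hw : IsTail a w) (hv : IsTail b v) (ha : ∀ k, ‖(a k : ℂ)‖ + 1 / 2 ≤ R k)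
    (hb : ∀ k, ‖(b k : ℂ)‖ + 1 / 2 ≤ R k) (n : ℕ) (hab : ∀ k < n, a k = b k) (hn : a n ≠ b n) :
    1 / 10 ≤ ‖w 0 - v 0‖ * ∏ k ∈ Finset.range (n + 1), R k ^ 2 := by
  have h := norm_sub_le_of_mul_eq_one (R := R n) (hw.mul_eq n) (hv.mul_eq n)
    ((norm_add_le _ _).trans (by linarith [ha n, hw.norm_le (n + 1)]))
    ((norm_add_le _ _).trans (by linarith [hb n, hv.norm_le (n + 1)]))
  have h2 : ‖(a n : ℂ) - b n‖ ≤ ‖(a n + w (n + 1)) - (b n + v (n + 1))‖ + ‖w (n + 1)‖ +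
      ‖v (n + 1)‖ := by
    have e : (a n : ℂ) - b n = ((a n + w (n + 1)) - (b n + v (n + 1))) - w (n + 1) + v (n + 1) := by
      ring
    exact (congrArg norm e).le.trans
      ((norm_add_le _ _).trans (by gcongr; exact norm_sub_le _ _))
  have h3 : ‖w n - v n‖ * R n ^ 2 ≤ (‖w 0 - v 0‖ * ∏ k ∈ Finset.range n, R k ^ 2) * R n ^ 2 := by
    gcongr
    exact hw.norm_sub_le_mul_prod hv ha hb n hab
  rw [Finset.prod_range_succ, ← mul_assoc]
  -- Distinct Gaussian integers are `1` apart and each tail takes away at most `9 / 20`, leaving `1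
  -- / 10`.
  linarith [one_le_norm_sub hn, hw.norm_le (n + 1), hv.norm_le (n + 1)]

/-! ### Mixed radix expansions of real numbers. -/

/-- The `n`-th remainder of the mixed radix expansion of `x` with bases `N`. -/
noncomputable def radixTail (N : ℕ → ℕ) (x : ℝ) : ℕ → ℝ
  | 0 => x
  | n + 1 => Int.fract (N n * radixTail N x n)

/-- The `n`-th digit of the mixed radix expansion of `x` with bases `N`. -/
noncomputable def radixDigit (N : ℕ → ℕ) (x : ℝ) (n : ℕ) : ℕ :=
  ⌊N n * radixTail N x n⌋₊

lemma radixTail_mem {N : ℕ → ℕ} {x : ℝ} (hx : x ∈ Set.Ico (0 : ℝ) 1) :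
    ∀ n, radixTail N x n ∈ Set.Ico (0 : ℝ) 1
  | 0 => hx
  | _ + 1 => ⟨Int.fract_nonneg _, Int.fract_lt_one _⟩

lemma radixDigit_lt {N : ℕ → ℕ} {x : ℝ} (hx : x ∈ Set.Ico (0 : ℝ) 1) {n : ℕ} (hN : 0 < N n) :
    radixDigit N x n < N n := by
  have hN' : (0 : ℝ) < N n := by exact_mod_cast hN
  obtain ⟨h0, h1⟩ := radixTail_mem (N := N) hx n
  rw [radixDigit, Nat.floor_lt (by positivity)]
  nlinarith

lemma radixTail_sub {N : ℕ → ℕ} {x y : ℝ} (hx : x ∈ Set.Ico (0 : ℝ) 1)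
    (hy : y ∈ Set.Ico (0 : ℝ) 1) (n : ℕ) (h : ∀ k < n, radixDigit N x k = radixDigit N y k) :
    radixTail N x n - radixTail N y n = (x - y) * ∏ k ∈ Finset.range n, (N k : ℝ) := by
  induction n with
  | zero => simp [radixTail]
  | succ n ih =>
    have h1 : 0 ≤ N n * radixTail N x n := mul_nonneg (by positivity) (radixTail_mem hx n).1
    have h2 : 0 ≤ N n * radixTail N y n := mul_nonneg (by positivity) (radixTail_mem hy n).1
    have h3 := h n n.lt_succ_self
    rw [radixDigit, radixDigit] at h3
    have e1 := natCast_floor_eq_intCast_floor h1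
    have e2 := natCast_floor_eq_intCast_floor h2
    rw [Finset.prod_range_succ, ← mul_assoc, ← ih fun k hk => h k (hk.trans n.lt_succ_self)]
    rw [h3] at e1
    simp only [radixTail, Int.fract]
    linarith

lemma abs_sub_mul_prod_le_one {N : ℕ → ℕ} {x y : ℝ} (hx : x ∈ Set.Ico (0 : ℝ) 1)
    (hy : y ∈ Set.Ico (0 : ℝ) 1) (n : ℕ) (h : ∀ k < n, radixDigit N x k = radixDigit N y k) :
    |x - y| * ∏ k ∈ Finset.range n, (N k : ℝ) ≤ 1 := by
  have e := radixTail_sub hx hy n h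
  have hp : (0 : ℝ) ≤ ∏ k ∈ Finset.range n, (N k : ℝ) := by positivity
  rw [← abs_of_nonneg hp, ← abs_mul, ← e, abs_le]
  obtain ⟨a1, a2⟩ := radixTail_mem (N := N) hx n
  obtain ⟨b1, b2⟩ := radixTail_mem (N := N) hy n
  constructor <;> linarith

lemma exists_radixDigit_ne {N : ℕ → ℕ} (hN : ∀ k, 2 ≤ N k) {x y : ℝ}
    (hx : x ∈ Set.Ico (0 : ℝ) 1) (hy : y ∈ Set.Ico (0 : ℝ) 1) (hxy : x ≠ y) :
    ∃ n, radixDigit N x n ≠ radixDigit N y n := by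
  by_contra! h
  have hpos : 0 < |x - y| := abs_pos.2 (sub_ne_zero.2 hxy)
  obtain ⟨n, hn⟩ := pow_unbounded_of_one_lt (1 / |x - y|) (one_lt_two (α := ℝ))
  have h1 := abs_sub_mul_prod_le_one hx hy n fun k _ => h k
  have h2 : (2 : ℝ) ^ n ≤ ∏ k ∈ Finset.range n, (N k : ℝ) := by
    have := Finset.prod_le_prod (s := Finset.range n) (f := fun _ => (2 : ℝ))
      (g := fun k => (N k : ℝ)) (fun _ _ => by norm_num) (fun k _ => by exact_mod_cast hN k)
    simpa using this
  rw [div_lt_iff₀ hpos] at hn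
  nlinarith

/-! ### Comparison of the two scales. -/

lemma exists_bound_of_eventually {u : ℕ → ℝ} {B : ℝ} (h : ∀ᶠ n in atTop, u n ≤ B) :
    ∃ C, 0 ≤ C ∧ ∀ n, u n ≤ C := by
  obtain ⟨n₀, hn₀⟩ := eventually_atTop.1 h
  refine ⟨|B| + ∑ k ∈ Finset.range n₀, |u k|, by positivity, fun n => ?_⟩
  rcases lt_or_ge n n₀ with hn | hn
  · have := Finset.single_le_sum (f := fun k => |u k|) (fun k _ => abs_nonneg _)
      (Finset.mem_range.2 hn)
    linarith [le_abs_self (u n), abs_nonneg B]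
  · have : 0 ≤ ∑ k ∈ Finset.range n₀, |u k| := by positivity
    linarith [hn₀ n hn, le_abs_self B]

lemma exists_bound_prod {p : ℕ → ℝ} (h0 : ∀ n, 0 ≤ p n) (h : ∀ᶠ n in atTop, p n ≤ 1) :
    ∃ C, 0 ≤ C ∧ ∀ n, ∏ k ∈ Finset.range n, p k ≤ C := by
  obtain ⟨n₀, hn₀⟩ := eventually_atTop.1 h
  refine exists_bound_of_eventually (B := ∏ k ∈ Finset.range n₀, p k) ?_
  filter_upwards [eventually_ge_atTop n₀] with n hn
  induction n, hn using Nat.le_induction with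
  | base => exact le_rfl
  | succ n hn ih =>
    rw [Finset.prod_range_succ]
    exact (mul_le_of_le_one_right (Finset.prod_nonneg fun k _ => h0 k) (hn₀ n hn)).trans ih

/-- The comparison of the two geometric scales that yields Hölder continuity with exponent
`r < 1`. -/
lemma exists_holder_const {F : ℕ → ℝ} {c L r : ℝ} (hF : ∀ n, 0 < F n)
    (hF_top : Tendsto F atTop atTop) (hF_exp : ∀ᶠ n : ℕ in atTop, F n ≤ Real.exp (n + 1))
    (hc : 0 < c) (hL : 0 < L) (hr0 : 0 < r) (hr1 : r < 1) :
    ∃ C, 0 ≤ C ∧ ∀ (n : ℕ) (X Y : ℝ), 0 ≤ X → 0 ≤ Y →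
      X * ∏ k ∈ Finset.range n, (c * F k ^ 2) ≤ 1 →
      1 / 10 ≤ Y * ∏ k ∈ Finset.range (n + 1), (L * F k) ^ 2 → X ≤ C * Y ^ r := by
  set q : ℕ → ℝ := fun k => ((L * F k) ^ 2) ^ r with hq
  have hqpos (k) : 0 < q k := Real.rpow_pos_of_pos (pow_pos (mul_pos hL (hF k)) 2) r
  have hqe (k) : q k = (L ^ 2) ^ r * F k ^ (2 * r) := by
    simp only [hq]
    rw [mul_pow, Real.mul_rpow (by positivity) (by positivity), ← Real.rpow_natCast (F k) 2,
      ← Real.rpow_mul (hF k).le]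
    norm_num
  -- The ratio `q k / (c * F k ^ 2)` is a constant times `F k ^ (2 * r - 2)`, which tends to `0`. A
  -- factor `exp 2` per digit is therefore free; it pays for the unmatched last factor `q n`.
  obtain ⟨C₁, hC₁, h₁⟩ := exists_bound_prod (p := fun k => q k / (c * F k ^ 2) * Real.exp 2)
    (fun k => by have := hqpos k; have := hF k; positivity) (by
      have ht : Tendsto (fun k => (L ^ 2) ^ r / c * Real.exp 2 * F k ^ (-(2 - 2 * r))) atTop
          (𝓝 ((L ^ 2) ^ r / c * Real.exp 2 * 0)) :=
        ((tendsto_rpow_neg_atTop (by linarith)).comp hF_top).const_mul _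
      rw [mul_zero] at ht
      filter_upwards [ht.eventually (gt_mem_nhds one_pos)] with k hk
      refine le_of_eq_of_le ?_ hk.le
      have e : F k ^ (-(2 - 2 * r)) = F k ^ (2 * r) / F k ^ 2 := by
        rw [← Real.rpow_natCast (F k) 2, ← Real.rpow_sub (hF k)]
        congr 1
        push_cast
        ring
      rw [e, hqe]
      have := hF k
      field_simp)
  obtain ⟨C₂, hC₂, h₂⟩ := exists_bound_of_eventually (u := fun n : ℕ => q n * Real.exp (-2 * n))
    (B := (L ^ 2) ^ r * Real.exp 2) (by
      filter_upwards [hF_exp] with n hn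
      have h1 : F n ^ (2 * r) ≤ Real.exp (2 * (n + 1)) := by
        calc F n ^ (2 * r) ≤ Real.exp (n + 1) ^ (2 * r) :=
              Real.rpow_le_rpow (hF n).le hn (by positivity)
          _ = Real.exp ((n + 1) * (2 * r)) := (Real.exp_mul _ _).symm
          _ ≤ _ := Real.exp_le_exp.2 (by nlinarith [n.cast_nonneg (α := ℝ)])
      rw [hqe, mul_assoc]
      gcongr
      calc F n ^ (2 * r) * Real.exp (-2 * n) ≤ Real.exp (2 * (n + 1)) * Real.exp (-2 * n) := by
            gcongr
        _ = Real.exp 2 := by rw [← Real.exp_add]; ring_nf)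
  refine ⟨C₁ * C₂ * 10 ^ r, by positivity, fun n X Y hX hY hXP hYQ => ?_⟩
  set P := ∏ k ∈ Finset.range n, (c * F k ^ 2) with hP
  have hPpos : 0 < P := Finset.prod_pos fun k _ => by have := hF k; positivity
  have hQ : 1 ≤ 10 ^ r * Y ^ r * ∏ k ∈ Finset.range (n + 1), q k := by
    rw [hq, Real.finsetProd_rpow _ _ fun k _ => by positivity, ← Real.mul_rpow (by norm_num) hY,
      ← Real.mul_rpow (by positivity) (Finset.prod_nonneg fun k _ => by positivity)]
    exact Real.one_le_rpow (by linarith) hr0.le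
  have h3 : (∏ k ∈ Finset.range n, q k) ≤ C₁ * P * Real.exp (-2 * n) := by
    have h := h₁ n
    rw [Finset.prod_mul_distrib, Finset.prod_div_distrib, Finset.prod_const, Finset.card_range,
      ← Real.exp_nat_mul, ← hP] at h
    have e : Real.exp (n * 2) * Real.exp (-2 * n) = 1 := by rw [← Real.exp_add]; simp [mul_comm]
    calc (∏ k ∈ Finset.range n, q k)
        = (∏ k ∈ Finset.range n, q k) / P * Real.exp (n * 2) * (P * Real.exp (-2 * n)) := by
          generalize Real.exp (-2 * (n : ℝ)) = E at e ⊢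
          field_simp
          linear_combination -(∏ k ∈ Finset.range n, q k) * e
      _ ≤ C₁ * (P * Real.exp (-2 * n)) := by gcongr
      _ = _ := by ring
  have h4 : ∏ k ∈ Finset.range (n + 1), q k ≤ C₁ * C₂ * P := by
    rw [Finset.prod_range_succ]
    calc (∏ k ∈ Finset.range n, q k) * q n ≤ C₁ * P * Real.exp (-2 * n) * q n := by
          have := (hqpos n).le
          gcongr
      _ = C₁ * P * (q n * Real.exp (-2 * n)) := by ring
      _ ≤ C₁ * P * C₂ := by gcongr; exact h₂ n
      _ = _ := by ring
  have hYr : 0 ≤ Y ^ r := Real.rpow_nonneg hY r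
  calc X ≤ X * (10 ^ r * Y ^ r * ∏ k ∈ Finset.range (n + 1), q k) :=
        le_mul_of_one_le_right hX hQ
    _ ≤ X * (10 ^ r * Y ^ r * (C₁ * C₂ * P)) := by gcongr
    _ = (X * P) * (C₁ * C₂ * 10 ^ r * Y ^ r) := by ring
    _ ≤ 1 * (C₁ * C₂ * 10 ^ r * Y ^ r) := by gcongr
    _ = _ := one_mul _

/-! ### Counting Gaussian integers in a band. -/

/-- An enumeration of the Gaussian integers `i + j * I` with `m ≤ i < m + K` and `0 ≤ j ≤ m`. -/
def bandDigit (m K d : ℕ) : GaussianInt := ⟨((m + d % K : ℕ) : ℤ), ((d / K : ℕ) : ℤ)⟩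

lemma bandDigit_injective (m K : ℕ) : Function.Injective (bandDigit m K) := by
  intro d e h
  have h1 : m + d % K = m + e % K := Int.ofNat_inj.1 (congrArg Zsqrtd.re h)
  have h2 : d / K = e / K := Int.ofNat_inj.1 (congrArg Zsqrtd.im h)
  rw [← Nat.div_add_mod d K, ← Nat.div_add_mod e K, h2, Nat.add_left_cancel h1]

lemma maxNorm_bandDigit {m K d : ℕ} (hd : d < K * (m + 1)) :
    maxNorm (bandDigit m K d) = (m + d % K : ℕ) := by
  have h : d / K ≤ m + d % K :=
    (Nat.lt_succ_iff.1 (Nat.div_lt_of_lt_mul hd)).trans (Nat.le_add_right _ _)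
  rw [maxNorm, bandDigit, GaussianInt.re_toComplex, GaussianInt.im_toComplex, Int.cast_natCast,
    Int.cast_natCast, Nat.abs_cast, Nat.abs_cast]
  exact max_eq_left (by exact_mod_cast h)

lemma norm_bandDigit_le {m K d : ℕ} (hK : 0 < K) (hd : d < K * (m + 1)) :
    ‖(bandDigit m K d : ℂ)‖ ≤ 2 * m + (K - 1) := by
  have h1 : ((d % K : ℕ) : ℝ) + 1 ≤ K := by exact_mod_cast Nat.mod_lt d hK
  have h2 : ((d / K : ℕ) : ℝ) ≤ m := by
    exact_mod_cast Nat.lt_succ_iff.1 (Nat.div_lt_of_lt_mul hd)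
  refine (Complex.norm_le_abs_re_add_abs_im _).trans ?_
  rw [bandDigit, GaussianInt.re_toComplex, GaussianInt.im_toComplex, Int.cast_natCast,
    Int.cast_natCast, Nat.abs_cast, Nat.abs_cast]
  push_cast
  linarith

/-- The band `φ ≤ ‖a‖ ≤ γ` contains at least `κ / 2 * φ ^ 2` Gaussian integers of modulus
`O(φ)`. -/
lemma exists_bandDigits {φ γ c' : ℝ} (hc0 : 0 < c') (hc1 : c' < 1) (hφ : 14 / 5 ≤ φ)
    (hφγ : φ < c' * γ) (hint : ∃ p : ℤ, φ ≤ p ∧ p ≤ γ) :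
    ∃ (N : ℕ) (D : ℕ → GaussianInt), 2 ≤ N ∧ (1 / c' - 1) / 2 * φ ^ 2 ≤ N ∧
      Function.Injective D ∧ ∀ d < N, φ ≤ maxNorm (D d) ∧ maxNorm (D d) ≤ γ ∧
        ‖(D d : ℂ)‖ + 1 / 2 ≤ (1 / c' + 2) * φ := by
  obtain ⟨κ, hκ⟩ : ∃ κ, κ = 1 / c' - 1 := ⟨_, rfl⟩
  have hc : 1 / c' = κ + 1 := by rw [hκ]; ring
  have hκ0 : 0 < κ := by rw [hκ, sub_pos]; exact one_lt_one_div hc0 hc1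
  have hγ : (κ + 1) * φ ≤ γ := by
    rw [← hc, one_div_mul_eq_div, div_le_iff₀ hc0, mul_comm γ]; exact hφγ.le
  obtain ⟨m, hm⟩ : ∃ m, m = ⌈φ⌉₊ := ⟨_, rfl⟩
  have hm1 : φ ≤ m := hm ▸ Nat.le_ceil φ
  have hm2 : (m : ℝ) < φ + 1 := hm ▸ Nat.ceil_lt_add_one (by linarith)
  have hm3 : (m : ℝ) ≤ γ := by
    obtain ⟨p, hp1, hp2⟩ := hint
    have hp0 : 0 ≤ p := by
      have : (0 : ℝ) ≤ p := by linarith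
      exact_mod_cast this
    lift p to ℕ using hp0
    rw [Int.cast_natCast] at hp1 hp2
    exact le_trans (by rw [hm]; exact_mod_cast Nat.ceil_le.2 hp1) hp2
  -- If `K ≤ κ * φ`, real parts stay below `φ + K ≤ (κ + 1) * φ ≤ γ`. The fallback `K = 1` uses only
  -- real part `m`, which is at most `γ` because the band contains an integer.
  obtain ⟨K, hK⟩ : ∃ K, K = max 1 ⌊κ * φ⌋₊ := ⟨_, rfl⟩
  have hK1 : 1 ≤ K := hK ▸ le_max_left _ _
  have hK1' : (1 : ℝ) ≤ K := by exact_mod_cast hK1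
  have hK2 : K = 1 ∨ (K : ℝ) ≤ κ * φ := by
    rcases max_choice 1 ⌊κ * φ⌋₊ with h | h
    · exact Or.inl (hK.trans h)
    · right
      rw [hK, h]
      exact Nat.floor_le (by positivity)
  have hK3 : κ * φ / 2 ≤ K := by
    have h1 : κ * φ < ⌊κ * φ⌋₊ + 1 := Nat.lt_floor_add_one _
    have h2 : (⌊κ * φ⌋₊ : ℝ) ≤ K := by rw [hK]; exact_mod_cast le_max_right _ _
    linarith
  have hK4 : (K : ℝ) - 1 ≤ κ * φ := by
    rcases hK2 with h | h
    · rw [h, Nat.cast_one, sub_self]; positivity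
    · linarith
  refine ⟨K * (m + 1), bandDigit m K, ?_, ?_, bandDigit_injective m K, fun d hd => ?_⟩
  · have : 1 ≤ m := by
      have : (0 : ℝ) < m := by linarith
      exact_mod_cast this
    nlinarith
  · push_cast
    rw [← hκ]
    calc κ / 2 * φ ^ 2 = κ * φ / 2 * φ := by ring
      _ ≤ K * (m + 1) := by gcongr; linarith
  · rw [maxNorm_bandDigit hd]
    push_cast
    refine ⟨?_, ?_, ?_⟩
    · linarith [(d % K).cast_nonneg (α := ℝ)]
    · rcases hK2 with h | h
      · simpa [h, Nat.mod_one] using hm3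
      · have h1 : ((d % K : ℕ) : ℝ) + 1 ≤ K := by exact_mod_cast Nat.mod_lt d hK1
        linarith
    -- Here `2 * m < 2 * φ + 2`, and the leftover `2 + 1 / 2` is at most `φ`.
    · have := norm_bandDigit_le hK1 hd
      rw [hc]
      linarith

lemma eventually_le_exp {g : ℕ → ℝ} (hg1 : ∀ᶠ n in atTop, 1 < g n)
    (hg : limsup (fun n : ℕ => ((Real.log (Real.log (g n)) / Real.log (n : ℝ) : ℝ) : EReal))
      atTop < 1) : ∀ᶠ n : ℕ in atTop, g n ≤ Real.exp n := by
  filter_upwards [hg1, eventually_lt_of_limsup_lt hg, eventually_gt_atTop 1] with n h1 h2 h3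
  have h3' : (1 : ℝ) < n := by exact_mod_cast h3
  have h4 : Real.log (Real.log (g n)) / Real.log n < 1 := by exact_mod_cast h2
  rw [div_lt_one (Real.log_pos h3'), Real.log_lt_log_iff (Real.log_pos h1) (by linarith),
    Real.log_lt_iff_lt_exp (by linarith)] at h4
  exact h4.le

lemma sqrt_eight_ge : 14 / 5 ≤ Real.sqrt 8 := Real.le_sqrt_of_sq_le (by norm_num)

/-! ### The lower bound. -/

lemma one_le_dimH_hurwitzBand (f g : ℕ → ℝ) (c' : ℝ) (hc'0 : 0 < c') (hc'1 : c' < 1)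
    (hf : ∀ n : ℕ, 1 ≤ n → Real.sqrt 8 ≤ f n)
    (hfg : ∀ n : ℕ, 1 ≤ n → f n < c' * g n)
    (hint : ∀ n : ℕ, 1 ≤ n → ∃ m : ℤ, f n ≤ (m : ℝ) ∧ (m : ℝ) ≤ g n)
    (hf_top : Tendsto f atTop atTop)
    (hg : limsup (fun n : ℕ => ((Real.log (Real.log (g n)) / Real.log (n : ℝ) : ℝ) : EReal))
      atTop < 1) :
    1 ≤ dimH (hurwitzBand f g) := by
  have hf' (n : ℕ) : 14 / 5 ≤ f (n + 1) := sqrt_eight_ge.trans (hf (n + 1) (by omega))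
  choose N D hN2 hN hDinj hD using fun n : ℕ => exists_bandDigits hc'0 hc'1 (hf' n)
    (hfg (n + 1) (by omega)) (hint (n + 1) (by omega))
  have hDx {x : ℝ} (hx : x ∈ Set.Ico (0 : ℝ) 1) (n : ℕ) :=
    hD n (radixDigit N x n) (radixDigit_lt hx (two_pos.trans_le (hN2 n)))
  have hex (x : ℝ) (hx : x ∈ Set.Ico (0 : ℝ) 1) :
      ∃ w, IsTail (fun n => D n (radixDigit N x n)) w :=
    exists_isTail _ fun k => (hf' k).trans ((hDx hx k).1.trans (maxNorm_le_norm _))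
  choose! w hw using hex
  have hmem : ∀ x ∈ Set.Ico (0 : ℝ) 1, w x 0 ∈ hurwitzBand f g := fun x hx => by
    refine ⟨(hw x hx).mem_square 0, (hw x hx).hasInfiniteHCF, fun n hn => ?_⟩
    obtain ⟨k, rfl⟩ := Nat.exists_eq_add_of_le' hn
    rw [(hw x hx).element_eq]
    exact ⟨(hDx hx k).1, (hDx hx k).2.1⟩
  have hF_top : Tendsto (fun n => f (n + 1)) atTop atTop :=
    hf_top.comp (tendsto_add_atTop_nat 1)
  have hfltg (n : ℕ) (hn : 1 ≤ n) : f n < g n := by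
    have h1 := hfg n hn
    have h2 := sqrt_eight_ge.trans (hf n hn)
    nlinarith
  have hF_exp : ∀ᶠ n : ℕ in atTop, f (n + 1) ≤ Real.exp (n + 1) := by
    have h := eventually_le_exp (g := g) (by
      filter_upwards [eventually_ge_atTop 1] with n hn
      linarith [sqrt_eight_ge, hf n hn, hfltg n hn]) hg
    filter_upwards [(tendsto_add_atTop_nat 1).eventually h] with n hn
    exact (hfltg (n + 1) (by omega)).le.trans (by exact_mod_cast hn)
  have hκ : 0 < (1 / c' - 1) / 2 := by
    have := one_lt_one_div hc'0 hc'1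
    linarith
  have key (r : NNReal) (hr0 : 0 < r) (hr1 : r < 1) : (r : ENNReal) ≤ dimH (hurwitzBand f g) := by
    obtain ⟨C, hC0, hC⟩ := exists_holder_const (r := r) (c := (1 / c' - 1) / 2) (L := 1 / c' + 2)
      (fun n => (by norm_num : (0 : ℝ) < 14 / 5).trans_le (hf' n)) hF_top hF_exp hκ
      (by positivity) hr0 hr1
    have hsep {x y : ℝ} (hx : x ∈ Set.Ico (0 : ℝ) 1) (hy : y ∈ Set.Ico (0 : ℝ) 1) :
        |x - y| ≤ C * ‖w x 0 - w y 0‖ ^ (r : ℝ) := by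
      rcases eq_or_ne x y with rfl | hxy
      · rw [sub_self, abs_zero]
        positivity
      have hdiff := exists_radixDigit_ne hN2 hx hy hxy
      classical
      have hlt : ∀ k < Nat.find hdiff, radixDigit N x k = radixDigit N y k := fun k hk =>
        not_not.1 (Nat.find_min hdiff hk)
      refine hC (Nat.find hdiff) _ _ (abs_nonneg _) (norm_nonneg _) ?_ ?_
      · refine le_trans ?_ (abs_sub_mul_prod_le_one hx hy (Nat.find hdiff) hlt)
        gcongr with k
        exact hN k
      · exact (hw x hx).separation (hw y hy) (fun k => (hDx hx k).2.2) (fun k => (hDx hy k).2.2)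
          _ (fun k hk => by rw [hlt k hk]) ((hDinj _).ne (Nat.find_spec hdiff))
    have hinj : Set.InjOn (fun x => w x 0) (Set.Ico (0 : ℝ) 1) := fun x hx y hy hxy => by
      have h := hsep hx hy
      simp only at hxy
      rw [hxy, sub_self, norm_zero, Real.zero_rpow (by exact_mod_cast hr0.ne'), mul_zero] at h
      exact sub_eq_zero.1 (abs_nonpos_iff.1 h)
    -- An `r`-Hölder map multiplies dimension by at most `1 / r`, and this one maps part of the band
    -- set onto `[0, 1)`.
    have hold : HolderOnWith C.toNNReal r (Function.invFunOn (fun x => w x 0) (Set.Ico (0 : ℝ) 1))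
        ((fun x => w x 0) '' Set.Ico (0 : ℝ) 1) := by
      rintro _ ⟨x, hx, rfl⟩ _ ⟨y, hy, rfl⟩
      rw [hinj.leftInvOn_invFunOn hx, hinj.leftInvOn_invFunOn hy, edist_dist, edist_dist,
        ENNReal.ofReal_rpow_of_nonneg dist_nonneg r.coe_nonneg, ← ENNReal.ofReal,
        ← ENNReal.ofReal_mul hC0, dist_eq_norm, Real.norm_eq_abs, dist_eq_norm]
      exact ENNReal.ofReal_le_ofReal (hsep hx hy)
    have h1 := hold.dimH_image_le hr0
    rw [hinj.leftInvOn_invFunOn.image_image, Real.dimH_of_nonempty_interior (by simp),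
      Module.finrank_self, Nat.cast_one,
      ENNReal.le_div_iff_mul_le (Or.inl (by exact_mod_cast hr0.ne')) (Or.inl ENNReal.coe_ne_top),
      one_mul] at h1
    exact h1.trans (dimH_mono (Set.image_subset_iff.2 hmem))
  refine le_of_forall_lt fun s hs => ?_
  obtain ⟨r, hsr, hr1⟩ := ENNReal.lt_iff_exists_nnreal_btwn.1 hs
  exact hsr.trans_le (key r (by exact_mod_cast zero_le.trans_lt hsr) (by exact_mod_cast hr1))

/-! ### The upper bound: covering by cylinders. -/

/-- The coordinates of a Gaussian integer, as a vector. -/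
def gaussianCoord (a : GaussianInt) : Fin 2 → ℤ := ![a.re, a.im]

lemma gaussianCoord_injective : Function.Injective gaussianCoord := fun _ _ h =>
  Zsqrtd.ext (congrFun h 0) (congrFun h 1)

lemma norm_gaussianCoord (a : GaussianInt) : ‖gaussianCoord a‖ = maxNorm a := by
  have h (i : Fin 2) : ‖gaussianCoord a i‖ ≤ maxNorm a := by
    fin_cases i
    · simp [gaussianCoord, maxNorm, Int.norm_eq_abs, GaussianInt.intCast_re]
    · simp [gaussianCoord, maxNorm, Int.norm_eq_abs, GaussianInt.intCast_im]
  refine le_antisymm ((pi_norm_le_iff_of_nonneg ((abs_nonneg _).trans (le_max_left _ _))).2 h)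
    (max_le ?_ ?_)
  · simpa [gaussianCoord, Int.norm_eq_abs, GaussianInt.intCast_re] using
      norm_le_pi_norm (gaussianCoord a) 0
  · simpa [gaussianCoord, Int.norm_eq_abs, GaussianInt.intCast_im] using
      norm_le_pi_norm (gaussianCoord a) 1

lemma finite_maxNorm_le (g : ℝ) : {a : GaussianInt | maxNorm a ≤ g}.Finite := by
  have h : (Metric.closedBall (0 : Fin 2 → ℤ) g).Finite :=
    (isCompact_closedBall (0 : Fin 2 → ℤ) g).finite_of_discrete
  refine (h.preimage gaussianCoord_injective.injOn).subset fun a ha => ?_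
  simpa [norm_gaussianCoord] using ha

/-- The Gaussian integers `a` with `f ≤ ‖a‖ ≤ g`. -/
noncomputable def bandFinset (f g : ℝ) : Finset GaussianInt := by
  classical exact (finite_maxNorm_le g).toFinset.filter fun a => f ≤ maxNorm a

lemma mem_bandFinset {f g : ℝ} {a : GaussianInt} :
    a ∈ bandFinset f g ↔ f ≤ maxNorm a ∧ maxNorm a ≤ g := by
  simp [bandFinset, and_comm]

/-- Up to a constant this is the sum of `‖v‖ ^ (-2 * s)` over a lattice of rank two, with `2 * s >
2`, as for Eisenstein series. -/
lemma summable_maxNorm_rpow {s : ℝ} (hs : 1 < s) :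
    Summable fun a : GaussianInt => (9 / 4 / maxNorm a ^ 2) ^ s := by
  have h := ((EisensteinSeries.summable_one_div_norm_rpow (k := 2 * s)
    (by linarith)).comp_injective gaussianCoord_injective).mul_left ((9 / 4 : ℝ) ^ s)
  refine h.congr fun a => ?_
  have h0 : 0 ≤ maxNorm a := (abs_nonneg _).trans (le_max_left _ _)
  rw [Function.comp_apply, norm_gaussianCoord, Real.div_rpow (x := 9 / 4) (by norm_num) (sq_nonneg _),
    Real.rpow_neg h0, Real.rpow_mul h0, div_eq_mul_inv _ (_ ^ s), Real.rpow_two]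

lemma eventually_sum_bandFinset_le_one {f g : ℕ → ℝ} (hf : Tendsto f atTop atTop) {s : ℝ}
    (hs : 1 < s) :
    ∀ᶠ n in atTop, ∑ a ∈ bandFinset (f n) (g n), (9 / 4 / maxNorm a ^ 2) ^ s ≤ 1 := by
  obtain ⟨S, hS⟩ := summable_iff_vanishing_norm.1 (summable_maxNorm_rpow hs) 1 one_pos
  -- The sum dominates `maxNorm a` for each `a ∈ S`, so the band eventually avoids `S`, whatever `g`
  -- is.
  filter_upwards [hf.eventually_gt_atTop (∑ a ∈ S, maxNorm a)] with n hn
  refine (le_abs_self _).trans (hS _ ?_).le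
  rw [Finset.disjoint_left]
  intro a ha haS
  have h1 := (mem_bandFinset.1 ha).1
  have h2 := Finset.single_le_sum (f := fun a : GaussianInt => maxNorm a)
    (fun a _ => (abs_nonneg _).trans (le_max_left _ _)) haS
  linarith

/-- Points of the same cylinder are close to each other. -/
lemma norm_remainder_sub_le {z y : ℂ} (hz : HasInfiniteHCF z) (hy : HasInfiniteHCF y) (n : ℕ)
    (h : ∀ k < n, hurwitzElement z (k + 1) = hurwitzElement y (k + 1))
    (hbig : ∀ k < n, Real.sqrt 8 ≤ maxNorm (hurwitzElement z (k + 1))) :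
    ‖hurwitzRemainder z 0 - hurwitzRemainder y 0‖ ≤
      2 * ∏ k ∈ Finset.range n, 9 / 4 / maxNorm (hurwitzElement z (k + 1)) ^ 2 := by
  suffices H : ‖hurwitzRemainder z 0 - hurwitzRemainder y 0‖ ≤
      ‖hurwitzRemainder z n - hurwitzRemainder y n‖ *
        ∏ k ∈ Finset.range n, 9 / 4 / maxNorm (hurwitzElement z (k + 1)) ^ 2 by
    refine H.trans (mul_le_mul_of_nonneg_right ?_ (Finset.prod_nonneg fun k _ => by positivity))
    refine (norm_sub_le _ _).trans ?_
    linarith [norm_le_of_mem_hurwitzSquare (hurwitzRemainder_mem z n),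
      norm_le_of_mem_hurwitzSquare (hurwitzRemainder_mem y n)]
  induction n with
  | zero => simp
  | succ n ih =>
    refine (ih (fun k hk => h k (by omega)) (fun k hk => hbig k (by omega))).trans ?_
    rw [Finset.prod_range_succ, mul_left_comm, mul_comm]
    refine mul_le_mul_of_nonneg_left ?_ (Finset.prod_nonneg fun k _ => by positivity)
    set a := hurwitzElement z (n + 1) with ha
    have hM : 14 / 5 ≤ maxNorm a := sqrt_eight_ge.trans (hbig n n.lt_succ_self)
    have hbd {x : ℂ} (hx : HasInfiniteHCF x) (hxa : hurwitzElement x (n + 1) = a) :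
        ‖hurwitzRemainder x n‖ ≤ 3 / 2 / maxNorm a := by
      have h1 := hurwitzRemainder_mul hx n
      rw [hxa] at h1
      have h2 := norm_le_of_mem_hurwitzSquare (hurwitzRemainder_mem x (n + 1))
      have h3 := norm_sub_le ((a : ℂ) + hurwitzRemainder x (n + 1)) (hurwitzRemainder x (n + 1))
      rw [add_sub_cancel_right] at h3
      have h4 := maxNorm_le_norm (a : ℂ)
      -- Remainders have modulus at most `3 / 4`, and `M - 3 / 4 ≥ 2 / 3 * M` once `M ≥ 9 / 4`;
      -- squaring the resulting `3 / 2` gives the `9 / 4`.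
      have h5 : 2 / 3 * maxNorm a ≤ ‖(a : ℂ) + hurwitzRemainder x (n + 1)‖ := by linarith
      have h6 := congrArg norm h1
      rw [norm_mul, norm_one] at h6
      rw [le_div_iff₀ (by linarith)]
      nlinarith [norm_nonneg (hurwitzRemainder x n)]
    have hya := (h n n.lt_succ_self).symm
    have e1 := hurwitzRemainder_mul hz n
    have e2 := hurwitzRemainder_mul hy n
    rw [hya] at e2
    have e : hurwitzRemainder z n - hurwitzRemainder y n =
        -(hurwitzRemainder z n * hurwitzRemainder y n *
          (hurwitzRemainder z (n + 1) - hurwitzRemainder y (n + 1))) := by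
      linear_combination hurwitzRemainder y n * e1 - hurwitzRemainder z n * e2
    rw [e, norm_neg, norm_mul, norm_mul, mul_comm]
    refine mul_le_mul_of_nonneg_left ?_ (norm_nonneg _)
    calc _ ≤ 3 / 2 / maxNorm a * (3 / 2 / maxNorm a) := by
          gcongr
          · exact hbd hz rfl
          · exact hbd hy hya
      _ = _ := by ring

open MeasureTheory MeasureTheory.Measure in
lemma dimH_hurwitzBand_le_one (f g : ℕ → ℝ) (hf : ∀ n : ℕ, 1 ≤ n → Real.sqrt 8 ≤ f n)
    (hf_top : Tendsto f atTop atTop) : dimH (hurwitzBand f g) ≤ 1 := by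
  refine le_of_forall_gt_imp_ge_of_dense fun s hs => ?_
  obtain ⟨s', h1s, hss⟩ := ENNReal.lt_iff_exists_nnreal_btwn.1 hs
  refine le_trans ?_ hss.le
  have h1s' : (1 : ℝ) < s' := by exact_mod_cast h1s
  let D : ℕ → Finset GaussianInt := fun k => bandFinset (f (k + 1)) (g (k + 1))
  let p : GaussianInt → ℝ := fun a => 9 / 4 / maxNorm a ^ 2
  have hp0 (a) : 0 ≤ p a := by positivity
  -- Each factor is at most `9 / 32`, so cylinder diameters tend to `0` uniformly, as the Hausdorff
  -- measure bound requires.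
  have hp1 (k) {a} (ha : a ∈ D k) : p a ≤ 1 / 2 := by
    have h2 : Real.sqrt 8 ≤ maxNorm a := (hf (k + 1) (by omega)).trans (mem_bandFinset.1 ha).1
    have h3 : 8 ≤ maxNorm a ^ 2 := (Real.sqrt_le_left ((Real.sqrt_nonneg 8).trans h2)).1 h2
    simp only [p]
    rw [div_le_iff₀ (by linarith)]
    linarith
  let ι : ℕ → Type := fun n => {c // c ∈ Fintype.piFinset fun k : Fin n => D k}
  let t : ∀ n, ι n → Set ℂ := fun n c =>
    {z ∈ hurwitzBand f g | ∀ k : Fin n, hurwitzElement z (k + 1) = c.1 k}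
  have hmem {z} (hz : z ∈ hurwitzBand f g) (k : ℕ) : hurwitzElement z (k + 1) ∈ D k :=
    mem_bandFinset.2 (hz.2.2 (k + 1) (by omega))
  have hdiam (n : ℕ) (c : ι n) : Metric.ediam (t n c) ≤ ENNReal.ofReal (2 * ∏ k, p (c.1 k)) := by
    refine Metric.ediam_le fun z hz y hy => ?_
    rw [edist_dist, dist_eq_norm]
    refine ENNReal.ofReal_le_ofReal ?_
    have h := norm_remainder_sub_le hz.1.2.1 hy.1.2.1 n
      (fun k hk => (hz.2 ⟨k, hk⟩).trans (hy.2 ⟨k, hk⟩).symm)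
      (fun k _ => (hf (k + 1) (by omega)).trans (hz.1.2.2 (k + 1) (by omega)).1)
    rw [hurwitzRemainder, hurwitzRemainder, nearestGaussian_eq_zero hz.1.1,
      nearestGaussian_eq_zero hy.1.1, GaussianInt.toComplex_zero, sub_zero, sub_zero,
      Finset.prod_range] at h
    simp only [p, ← hz.2]
    exact h
  obtain ⟨C, hC0, hC⟩ := exists_bound_prod (p := fun k => ∑ a ∈ D k, p a ^ (s' : ℝ))
    (fun k => Finset.sum_nonneg fun a _ => Real.rpow_nonneg (hp0 a) _)
    (eventually_sum_bandFinset_le_one (g := fun k => g (k + 1))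
      (hf_top.comp (tendsto_add_atTop_nat 1)) h1s')
  have hr : Tendsto (fun n : ℕ => ENNReal.ofReal (2 * (1 / 2) ^ n)) atTop (𝓝 0) := by
    have h := ENNReal.tendsto_ofReal
      ((tendsto_pow_atTop_nhds_zero_of_lt_one (r := (1 / 2 : ℝ)) (by norm_num)
        (by norm_num)).const_mul 2)
    simpa using h
  have hle := hausdorffMeasure_le_liminf_sum (s' : ℝ) (hurwitzBand f g) _ hr t
    (Eventually.of_forall fun n c => (hdiam n c).trans (ENNReal.ofReal_le_ofReal (by
      gcongr
      calc ∏ k, p (c.1 k) ≤ ∏ _k : Fin n, (1 / 2 : ℝ) :=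
            Finset.prod_le_prod (fun k _ => hp0 _) fun k _ =>
              hp1 k (Fintype.mem_piFinset.1 c.2 k)
        _ = (1 / 2) ^ n := by simp)))
    (Eventually.of_forall fun n z hz => Set.mem_iUnion.2
      ⟨⟨fun k => hurwitzElement z (k + 1), Fintype.mem_piFinset.2 fun k => hmem hz k⟩,
        hz, fun _ => rfl⟩)
  -- The sum over words of length `n` factors into a product of sums over single digits.
  have hsum (n : ℕ) : ∑ c, Metric.ediam (t n c) ^ (s' : ℝ) ≤ ENNReal.ofReal (2 ^ (s' : ℝ) * C) := by
    calc ∑ c, Metric.ediam (t n c) ^ (s' : ℝ)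
        ≤ ∑ c : ι n, ENNReal.ofReal (2 ^ (s' : ℝ) * ∏ k, p (c.1 k) ^ (s' : ℝ)) := by
          refine Finset.sum_le_sum fun c _ => ?_
          have hpr : 0 ≤ ∏ k, p (c.1 k) := Finset.prod_nonneg fun k _ => hp0 _
          refine (ENNReal.rpow_le_rpow (hdiam n c) s'.coe_nonneg).trans_eq ?_
          rw [ENNReal.ofReal_rpow_of_nonneg (by positivity) s'.coe_nonneg,
            Real.mul_rpow (by norm_num) hpr, Real.finsetProd_rpow _ _ fun k _ => hp0 _]
      _ = ENNReal.ofReal (2 ^ (s' : ℝ) * ∏ k ∈ Finset.range n, ∑ a ∈ D k, p a ^ (s' : ℝ)) := by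
          rw [← ENNReal.ofReal_sum_of_nonneg fun c _ => mul_nonneg (by positivity)
            (Finset.prod_nonneg fun k _ => Real.rpow_nonneg (hp0 _) _), ← Finset.mul_sum,
            Finset.prod_range, Finset.prod_univ_sum,
            ← Finset.sum_coe_sort (Fintype.piFinset fun k : Fin n => D k)]
      _ ≤ _ := by
          gcongr
          exact hC n
  refine dimH_le_of_hausdorffMeasure_ne_top (ne_top_of_le_ne_top
    (ENNReal.ofReal_ne_top (r := 2 ^ (s' : ℝ) * C)) (hle.trans ?_))
  exact liminf_le_of_frequently_le' (Frequently.of_forall hsum)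

theorem lemma4p2 (f g : ℕ → ℝ) (c' : ℝ) (hc'0 : 0 < c') (hc'1 : c' < 1)
    (hf : ∀ n : ℕ, 1 ≤ n → Real.sqrt 8 ≤ f n)
    (hfg : ∀ n : ℕ, 1 ≤ n → f n < c' * g n)
    (hint : ∀ n : ℕ, 1 ≤ n → ∃ m : ℤ, f n ≤ (m : ℝ) ∧ (m : ℝ) ≤ g n)
    (hf_top : Tendsto f atTop atTop)
    (hg : limsup (fun n : ℕ => ((Real.log (Real.log (g n)) / Real.log (n : ℝ) : ℝ) : EReal))
      atTop < 1) :
    dimH (hurwitzBand f g) = 1 :=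
  le_antisymm (dimH_hurwitzBand_le_one f g hf hf_top)
    (one_le_dimH_hurwitzBand f g c' hc'0 hc'1 hf hfg hint hf_top hg)
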